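/- Consider a server with $N$ independent files $W_1,\dots,W_N$, each uniformly distributed on $[2^F]=\{1,\dots,2^F\}$, and $K$ users. For real $M,R\ge 0$ and an integer $F\ge 1$, an $(M,R,F)$ caching and delivery code consists of caching functions $\phi_k:[2^F]^N\to[2^{\lfloor FM\rfloor}]$, $k\in[K]$, a delivery function $\psi:[2^F]^N\times[N]^K\to[2^{\lfloor FR\rfloor}]$, and decoding functions $\mu_k:[2^{\lfloor FM\rfloor}]\times[2^{\lfloor FR\rfloor}]\times[N]^K\to[2^F]$, $k\in[K]$. With $\mathbf W=(W_1,\dots,W_N)$ and $\hat W_k=\mu_k(\phi_k(\mathbf W),\psi(\mathbf W,\mathbf d),\mathbf d)$, its error probability is $$P_e=\max_{\mathbf d\in[N]^K}\Pr\Big\{\bigcup_{k=1}^K\{\hat W_k\ne W_{d_k}\}\Big\}.$$ The pair $(R,M)$ is achievable if for every $\varepsilon>0$ there are an $F\ge 1$ and an $(M,R,F)$ code with $P_e<\varepsilon$, and the optimal delivery rate is $R^*(M)=\inf\{R\ge 0:(R,M)\text{ is achievable}\}$. **Theorem.** Let $K>N\ge 3$ be integers, let $M\in[1/K,(N-1)/K]$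 be real, and let $$R_c(M)=-N\Big(\frac M2-1+\frac1{2K}\Big)$$ be the delivery rate of the proposed coded caching scheme. Then $R_c(M)$ is achieved, in the sense that $(R,M)$ is achievable for every $R>R_c(M)$ (so $R^*(M)\le R_c(M)$); moreover $R^*(M)>0$ and $$\frac{R_c(M)}{R^*(M)}\le 2 .$$ -/

import Mathlib

/-- An `(M, R, F)` caching and delivery code for `N` files of `F` bits and `K` users.
A file is an element of `Fin (2 ^ F)`, a database is a map `Fin N → Fin (2 ^ F)` and a demand
vector is a map `Fin K → Fin N`. The code is only used with `0 ≤ M` and `0 ≤ R`, where the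
natural-number floor is the usual floor. -/
structure CachingCode (N K : ℕ) (M R : ℝ) (F : ℕ) where
  /-- the caching functions, giving the cache content of each user -/
  cache : Fin K → (Fin N → Fin (2 ^ F)) → Fin (2 ^ ⌊(F : ℝ) * M⌋₊)
  /-- the delivery encoding function, giving the message over the shared link -/
  encode : (Fin N → Fin (2 ^ F)) → (Fin K → Fin N) → Fin (2 ^ ⌊(F : ℝ) * R⌋₊)
  /-- the decoding functions -/
  decode : Fin K → Fin (2 ^ ⌊(F : ℝ) * M⌋₊) → Fin (2 ^ ⌊(F : ℝ) * R⌋₊) →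
    (Fin K → Fin N) → Fin (2 ^ F)

namespace CachingCode

variable {N K F : ℕ} {M R : ℝ}

/-- The file that user `k` reconstructs when the database is `W` and the demand vector is `d`. -/
def reconstruct (C : CachingCode N K M R F) (W : Fin N → Fin (2 ^ F)) (d : Fin K → Fin N)
    (k : Fin K) : Fin (2 ^ F) :=
  C.decode k (C.cache k W) (C.encode W d) d

/-- The probability, for the demand vector `d`, that some user fails to reconstruct the file it
requested. The files are independent and uniform, so the database is uniformly distributed. -/
noncomputable def errorProbOf (C : CachingCode N K M R F) (d : Fin K → Fin N) : ℝ :=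
  ((Finset.univ.filter fun W : Fin N → Fin (2 ^ F) =>
      ∃ k, C.reconstruct W d k ≠ W (d k)).card : ℝ) /
    (Fintype.card (Fin N → Fin (2 ^ F)) : ℝ)

/-- The probability of error of a code: the maximum over the (finitely many) demand vectors. -/
noncomputable def errorProb (C : CachingCode N K M R F) : ℝ :=
  ⨆ d : Fin K → Fin N, C.errorProbOf d

end CachingCode

/-- The delivery rate-cache capacity pair `(R, M)` is achievable: for every `ε > 0` there are a
file length `F ≥ 1` and an `(M, R, F)` code whose probability of error is below `ε`.
Asking for `F` to exceed an arbitrary bound gives the same notion, since a code of length `F` can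
be repeated on consecutive blocks. -/
def Achievable (N K : ℕ) (R M : ℝ) : Prop :=
  0 ≤ R ∧ ∀ ε : ℝ, 0 < ε → ∃ F : ℕ, 0 < F ∧ ∃ C : CachingCode N K M R F, C.errorProb < ε

/-- The optimal delivery rate `R*(M)`. -/
noncomputable def optimalRate (N K : ℕ) (M : ℝ) : ℝ :=
  sInf {R : ℝ | Achievable N K R M}

/-- The delivery rate `R_c(M)` of the proposed scheme for `1 / K ≤ M ≤ (N - 1) / K`. -/
noncomputable def proposedRate (N K : ℕ) (M : ℝ) : ℝ :=
  -(N : ℝ) * (1 / 2 * M - 1 + 1 / (2 * (K : ℝ)))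

/- Achievability is memory sharing between two zero-error linear schemes, in both of which a file
consists of `K` symbols. With coded prefetching a user caches one symbol, the sum over all files of
its own position, at rate `N - N / K`; with uncoded prefetching it caches its position of every
file, at rate `N - N (N + 1) / (2 K)`. These are the values of `R_c` at `M = 1 / K` and `M = N / K`,
and `R_c` is affine. Conversely, the caches of `⌈N / 2⌉` users and two transmissions determine all
files, so `N ≤ ⌈N / 2⌉ M + 2 R`, which is at least as strong as `R_c(M) ≤ 2 R` when `M ≤ N / K`. -/

/-! ### Zero-error schemes -/

section Delivery

variable {N K : ℕ} {A A' X X' : Type*} {d : Fin K → Fin N}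

/-- The demand vector `d` can be served without error by `r` transmitted bits when the users hold
the contents `cache`. Instead of naming decoders, we ask that the cache of a user and the message
determine the requested file. -/
def IsDeliverable (cache : Fin K → (Fin N → A) → X) (d : Fin K → Fin N) (r : ℕ) : Prop :=
  ∃ encode : (Fin N → A) → Fin (2 ^ r), ∀ k W W',
    cache k W = cache k W' → encode W = encode W' → W (d k) = W' (d k)

/-- Files of `f` bits can be served without error, for every demand vector, with caches of `c` bits
and messages of `r` bits. -/
def HasZeroErrorScheme (N K f c r : ℕ) : Prop :=
  ∃ cache : Fin K → (Fin N → Fin (2 ^ f)) → Fin (2 ^ c), ∀ d, IsDeliverable cache d r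

namespace IsDeliverable

theorem of_card_le {cache : Fin K → (Fin N → A) → X} {r : ℕ} {Y : Type*} [Fintype Y]
    (hY : Fintype.card Y ≤ 2 ^ r) (encode : (Fin N → A) → Y)
    (h : ∀ k W W', cache k W = cache k W' → encode W = encode W' → W (d k) = W' (d k)) :
    IsDeliverable cache d r := by
  obtain ⟨ι⟩ : Nonempty (Y ↪ Fin (2 ^ r)) :=
    Function.Embedding.nonempty_of_card_le (by simpa using hY)
  exact ⟨ι ∘ encode, fun k W W' hc he => h k W W' hc (ι.injective he)⟩

theorem of_addMonoidHom [AddCommGroup A] [AddGroup X] {r : ℕ} {Y : Type*} [AddGroup Y] [Fintype Y]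
    (cache : Fin K → (Fin N → A) →+ X) (hY : Fintype.card Y ≤ 2 ^ r) (encode : (Fin N → A) →+ Y)
    (h : ∀ k W, cache k W = 0 → encode W = 0 → W (d k) = 0) :
    IsDeliverable (fun k => cache k) d r :=
  of_card_le hY encode fun k W W' hc he => sub_eq_zero.mp <|
    h k (W - W') (by rw [map_sub, hc, sub_self]) (by rw [map_sub, he, sub_self])

theorem of_not_surjective [Fintype A] {f r : ℕ} (cache : Fin K → (Fin N → A) → X)
    (hA : Fintype.card A = 2 ^ f) (hr : f * (N - 1) ≤ r) (hd : ¬Function.Surjective d) :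
    IsDeliverable cache d r := by
  obtain ⟨n₀, hn₀⟩ := not_forall.mp hd
  refine of_card_le (Y := {n // n ≠ n₀} → A) ?_ (fun W n => W n) fun k W W' _ he =>
    congrFun he ⟨d k, fun h => hn₀ ⟨k, h⟩⟩
  simpa [hA, ← pow_mul] using Nat.pow_le_pow_right two_pos hr

theorem prod {cache : Fin K → (Fin N → A) → X} {cache' : Fin K → (Fin N → A') → X'} {r r' : ℕ}
    (h : IsDeliverable cache d r) (h' : IsDeliverable cache' d r') :
    IsDeliverable (fun k (W : Fin N → A × A') =>
      (cache k (Prod.fst ∘ W), cache' k (Prod.snd ∘ W))) d (r + r') := by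
  obtain ⟨encode, h⟩ := h
  obtain ⟨encode', h'⟩ := h'
  refine of_card_le (Y := Fin (2 ^ r) × Fin (2 ^ r')) (by simp [pow_add])
    (fun W => (encode (Prod.fst ∘ W), encode' (Prod.snd ∘ W))) fun k W W' hc he => ?_
  obtain ⟨hc, hc'⟩ := Prod.mk.inj hc
  obtain ⟨he, he'⟩ := Prod.mk.inj he
  exact Prod.ext (h k _ _ hc he) (h' k _ _ hc' he')

end IsDeliverable

theorem exists_add_eq_and_le_mul {t : ℝ} (ht₀ : 0 ≤ t) (ht₁ : t ≤ 1) (L : ℕ) :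
    ∃ a b : ℕ, a + b = L ∧ (b : ℝ) ≤ t * L ∧ (a : ℝ) ≤ (1 - t) * L + 1 := by
  have hb : (⌊t * L⌋₊ : ℝ) ≤ t * L := Nat.floor_le (by positivity)
  have hbL : ⌊t * L⌋₊ ≤ L := by
    exact_mod_cast hb.trans (mul_le_of_le_one_left (Nat.cast_nonneg L) ht₁)
  refine ⟨L - ⌊t * L⌋₊, ⌊t * L⌋₊, Nat.sub_add_cancel hbL, hb, ?_⟩
  rw [Nat.cast_sub hbL]
  linarith [Nat.lt_floor_add_one (t * L)]

namespace HasZeroErrorScheme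

variable {f f' c c' r r' : ℕ}

theorem of_card [Fintype A] [Fintype X] (hA : Fintype.card A = 2 ^ f)
    (hX : Fintype.card X ≤ 2 ^ c) (cache : Fin K → (Fin N → A) → X)
    (h : ∀ d, IsDeliverable cache d r) : HasZeroErrorScheme N K f c r := by
  let α : Fin (2 ^ f) ≃ A := (Fintype.equivFinOfCardEq hA).symm
  obtain ⟨ι⟩ : Nonempty (X ↪ Fin (2 ^ c)) :=
    Function.Embedding.nonempty_of_card_le (by simpa using hX)
  refine ⟨fun k W => ι (cache k (α ∘ W)), fun d => ?_⟩
  obtain ⟨encode, hdec⟩ := h d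
  exact ⟨fun W => encode (α ∘ W), fun k W W' hc he =>
    α.injective (hdec k _ _ (ι.injective hc) he)⟩

theorem zero : HasZeroErrorScheme N K 0 0 0 :=
  ⟨fun _ _ => 0, fun _ => ⟨fun _ => 0, fun _ _ _ _ _ => Subsingleton.elim (α := Fin 1) _ _⟩⟩

theorem add (h : HasZeroErrorScheme N K f c r) (h' : HasZeroErrorScheme N K f' c' r') :
    HasZeroErrorScheme N K (f + f') (c + c') (r + r') := by
  obtain ⟨cache, h⟩ := h
  obtain ⟨cache', h'⟩ := h'
  exact of_card (by simp [pow_add]) (by simp [pow_add]) _ fun d => (h d).prod (h' d)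

theorem nsmul (h : HasZeroErrorScheme N K f c r) (m : ℕ) :
    HasZeroErrorScheme N K (m * f) (m * c) (m * r) := by
  induction m with
  | zero => simpa only [zero_mul] using zero
  | succ m ih => simpa only [Nat.succ_mul] using ih.add h

theorem exists_errorProb_eq_zero {M R : ℝ} (h : HasZeroErrorScheme N K f c r)
    (hM : (c : ℝ) ≤ f * M) (hR : (r : ℝ) ≤ f * R) :
    ∃ C : CachingCode N K M R f, C.errorProb = 0 := by
  obtain ⟨cache, h⟩ := h
  choose encode hdec using h
  have hc : 2 ^ c ≤ 2 ^ ⌊(f : ℝ) * M⌋₊ := Nat.pow_le_pow_right two_pos (Nat.le_floor hM)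
  have hr : 2 ^ r ≤ 2 ^ ⌊(f : ℝ) * R⌋₊ := Nat.pow_le_pow_right two_pos (Nat.le_floor hR)
  let view (d : Fin K → Fin N) (k : Fin K) (W : Fin N → Fin (2 ^ f)) :=
    (Fin.castLE hc (cache k W), Fin.castLE hr (encode d W))
  let C : CachingCode N K M R f :=
    { cache := fun k W => Fin.castLE hc (cache k W)
      encode := fun W d => Fin.castLE hr (encode d W)
      decode := fun k x y d => Function.invFun (view d k) (x, y) (d k) }
  have hC : ∀ W d k, C.reconstruct W d k = W (d k) := fun W d k => by
    have hview : view d k (Function.invFun (view d k) (view d k W)) = view d k W :=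
      Function.invFun_eq ⟨W, rfl⟩
    obtain ⟨hcache, hencode⟩ := Prod.mk.inj hview
    exact hdec d k _ _ (Fin.castLE_injective hc hcache) (Fin.castLE_injective hr hencode)
  exact ⟨C, by simp [CachingCode.errorProb, CachingCode.errorProbOf, hC]⟩

theorem achievable_of_memory_sharing {M R t : ℝ} (h : HasZeroErrorScheme N K f c r)
    (h' : HasZeroErrorScheme N K f c' r') (hc : c ≤ c') (hf : 0 < f) (ht₀ : 0 ≤ t) (ht₁ : t ≤ 1)
    (hM : (1 - t) * c + t * c' ≤ f * M) (hR : (1 - t) * r + t * r' < f * R) :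
    Achievable N K R M := by
  have hf' : (0 : ℝ) < f := by exact_mod_cast hf
  have hrate : 0 ≤ (1 - t) * r + t * r' := by
    have := sub_nonneg.mpr ht₁
    positivity
  refine ⟨(pos_of_mul_pos_right (hrate.trans_lt hR) hf'.le).le, fun ε hε => ?_⟩
  -- `L` copies leave enough slack in the rate to pay for rounding the proportions.
  obtain ⟨L, hL⟩ := exists_nat_gt (r / (f * R - ((1 - t) * r + t * r')))
  rw [div_lt_iff₀ (sub_pos.mpr hR)] at hL
  have hL₀ : 0 < L := Nat.pos_of_ne_zero fun h₀ => by
    rw [h₀, Nat.cast_zero, zero_mul] at hL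
    exact absurd hL (Nat.cast_nonneg r).not_gt
  obtain ⟨a, b, rfl, hb, ha⟩ := exists_add_eq_and_le_mul ht₀ ht₁ L
  have hcache : ((a * c + b * c' : ℕ) : ℝ) ≤ (a * f + b * f : ℕ) * M := by
    have hc' : (0 : ℝ) ≤ c' - c := sub_nonneg.mpr (by exact_mod_cast hc)
    push_cast at hb ⊢
    calc (a * c + b * c' : ℝ) = (a + b) * c + b * (c' - c) := by ring
      _ ≤ (a + b) * c + t * (a + b) * (c' - c) := by gcongr
      _ = (a + b) * ((1 - t) * c + t * c') := by ring
      _ ≤ (a + b) * (f * M) := by gcongr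
      _ = (a * f + b * f) * M := by ring
  have hmessage : ((a * r + b * r' : ℕ) : ℝ) ≤ (a * f + b * f : ℕ) * R := by
    push_cast at ha hb hL ⊢
    calc (a * r + b * r' : ℝ) ≤ ((1 - t) * (a + b) + 1) * r + t * (a + b) * r' := by gcongr
      _ = (a + b) * ((1 - t) * r + t * r') + r := by ring
      _ ≤ (a * f + b * f) * R := by linarith
  obtain ⟨C, hC⟩ := ((h.nsmul a).add (h'.nsmul b)).exists_errorProb_eq_zero hcache hmessage
  exact ⟨a * f + b * f, by rw [← add_mul]; exact Nat.mul_pos hL₀ hf, C, hC ▸ hε⟩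

end HasZeroErrorScheme

end Delivery

/-! ### Coded and uncoded prefetching -/

section Prefetching

variable {N K : ℕ} {G : Type*} [AddCommGroup G] {d : Fin K → Fin N} {l : Fin N → Fin K}

/-- The cache of user `k` under coded prefetching. -/
def codedCache (k : Fin K) : (Fin N → Fin K → G) →+ G :=
  AddMonoidHom.mk' (fun W => ∑ n, W n k) fun W W' => by simp [Finset.sum_add_distrib]

/-- The cache of user `k` under uncoded prefetching. -/
def uncodedCache (k : Fin K) : (Fin N → Fin K → G) →+ (Fin N → G) :=
  AddMonoidHom.mk' (fun W n => W n k) fun _ _ => rfl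

/-- The message for the demand vector `d` under coded prefetching, where user `l n` is the leader
of the users who request file `n`. Symbols cached by a user who requests another file are sent
plainly; the others are only needed relative to the symbol of the leader. -/
def codedDelivery (d : Fin K → Fin N) (l : Fin N → Fin K) :
    (Fin N → Fin K → G) →+ ((n : Fin N) → {j // j ≠ l n} → G) :=
  AddMonoidHom.mk' (fun W n j => if d j = n then W n j - W n (l n) else W n j) fun W W' => by
    ext n j
    simp only [Pi.add_apply]
    split_ifs <;> abel

/-- The difference of the symbols that users `i` and `j` want from each other, if user `k` holds the
`k`-th symbol of every file. -/
def crossDiff (d : Fin K → Fin N) (W : Fin N → Fin K → G) (i j : Fin K) : G :=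
  W (d i) j - W (d j) i

/-- The message for the demand vector `d` under uncoded prefetching, where the users `l n` are
leaders. For every pair of users, one of whom is a leader, it combines the two symbols that they
want from each other; `Finset.Iic n` avoids listing a pair twice. -/
def uncodedDelivery (d : Fin K → Fin N) (l : Fin N → Fin K) :
    (Fin N → Fin K → G) →+ ((n : Fin N) → {j // j ∉ (Finset.Iic n).image l} → G) :=
  AddMonoidHom.mk' (fun W n j => crossDiff d W (l n) j) fun W W' => by
    ext n j
    simp only [crossDiff, Pi.add_apply]
    abel

theorem eq_zero_of_codedDelivery_eq_zero (hl : Function.RightInverse l d) {k : Fin K}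
    {W : Fin N → Fin K → G} (hcache : codedCache k W = 0) (hmessage : codedDelivery d l W = 0) :
    W (d k) = 0 := by
  have hsent (n : Fin N) (j : Fin K) (hj : j ≠ l n) :
      (if d j = n then W n j - W n (l n) else W n j) = 0 :=
    congrFun (congrFun hmessage n) ⟨j, hj⟩
  have hplain (n : Fin N) (j : Fin K) (hj : d j ≠ n) : W n j = 0 := by
    simpa only [if_neg hj] using hsent n j fun h => hj (by rw [h, hl n])
  have hleader (j : Fin K) : W (d j) j = W (d j) (l (d j)) := by
    by_cases hj : j = l (d j)
    · rw [← hj]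
    · simpa only [if_true, sub_eq_zero] using hsent (d j) j hj
  have hown : W (d k) k = 0 :=
    (Fintype.sum_eq_single (d k) fun n hn => hplain n k hn.symm).symm.trans hcache
  funext j
  by_cases hj : d j = d k
  · calc W (d k) j = W (d k) (l (d k)) := by rw [← hj, hleader]
      _ = W (d k) k := (hleader k).symm
      _ = 0 := hown
  · exact hplain _ _ hj

theorem HasZeroErrorScheme.coded (hNK : N ≤ K) : HasZeroErrorScheme N K K 1 (N * K - N) := by
  refine of_card (A := Fin K → ZMod 2) (by simp) (by simp)
    (fun k => codedCache (G := ZMod 2) k) fun d => ?_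
  by_cases hd : Function.Surjective d
  · obtain ⟨l, hl⟩ := hd.hasRightInverse
    refine .of_addMonoidHom (codedCache (G := ZMod 2)) ?_ (codedDelivery d l) fun k W =>
      eq_zero_of_codedDelivery_eq_zero hl
    simp [← pow_mul, mul_comm N, Nat.sub_mul]
  · have hr : K * (N - 1) ≤ N * K - N := by
      rw [Nat.mul_sub, mul_comm K N, mul_one]
      omega
    exact .of_not_surjective _ (by simp) hr hd

theorem exists_injective_apply_apply_apply_eq {α β : Type*} [Fintype α] [Fintype β]
    (h : Fintype.card β ≤ Fintype.card α) (d : α → β) :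
    ∃ l : β → α, Function.Injective l ∧ ∀ a, d (l (d a)) = d a := by
  classical
  rcases isEmpty_or_nonempty α with hα | hα
  · have : IsEmpty β := Fintype.card_eq_zero_iff.mp (by simpa using h)
    exact ⟨isEmptyElim, Function.injective_of_subsingleton _, isEmptyElim⟩
  have hright (b : β) (hb : b ∈ Set.range d) : d (Function.invFun d b) = b := Function.invFun_eq hb
  obtain ⟨S, hS, -, hcard⟩ := Finset.exists_subsuperset_card_eq
    (Finset.subset_univ ((Finset.univ.image d).image (Function.invFun d))) (n := Fintype.card β)
    (Finset.card_image_le.trans (Finset.card_le_univ _)) (by simpa using h)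
  obtain ⟨l, hl⟩ := Finset.exists_equiv_extend_of_card_eq hcard.symm hS
    (Set.LeftInvOn.injOn (f₁' := d) fun b hb => hright b (by simpa using hb))
  refine ⟨Subtype.val ∘ l, Subtype.val_injective.comp l.injective, fun a => ?_⟩
  rw [Function.comp_apply, hl _ (Finset.mem_image_of_mem d (Finset.mem_univ a)),
    hright _ ⟨a, rfl⟩]

theorem crossDiff_swap (W : Fin N → Fin K → G) (i j : Fin K) :
    crossDiff d W j i = -crossDiff d W i j :=
  (neg_sub _ _).symm

theorem crossDiff_eq_of_leaders (hl : ∀ k, d (l (d k)) = d k) (W : Fin N → Fin K → G)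
    (i j : Fin K) :
    crossDiff d W i j = crossDiff d W (l (d i)) j - crossDiff d W (l (d j)) i -
      crossDiff d W (l (d i)) (l (d j)) := by
  simp only [crossDiff, hl]
  abel

theorem crossDiff_leader_eq_zero (hinj : Function.Injective l) {W : Fin N → Fin K → G}
    (hmessage : uncodedDelivery d l W = 0) (n : Fin N) (j : Fin K) :
    crossDiff d W (l n) j = 0 := by
  have hsent (n : Fin N) (j : Fin K) (hj : j ∉ (Finset.Iic n).image l) :
      crossDiff d W (l n) j = 0 :=
    congrFun (congrFun hmessage n) ⟨j, hj⟩
  by_cases hj : j ∈ (Finset.Iic n).image l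
  · obtain ⟨m, hm, rfl⟩ := Finset.mem_image.mp hj
    rcases (Finset.mem_Iic.mp hm).eq_or_lt with rfl | hlt
    · exact sub_self _
    · have hn : l n ∉ (Finset.Iic m).image l := by
        simpa [hinj.eq_iff] using hlt
      rw [crossDiff_swap, hsent m (l n) hn, neg_zero]
  · exact hsent n j hj

theorem eq_zero_of_uncodedDelivery_eq_zero (hinj : Function.Injective l)
    (hl : ∀ k, d (l (d k)) = d k) {k : Fin K} {W : Fin N → Fin K → G}
    (hcache : ∀ n, W n k = 0) (hmessage : uncodedDelivery d l W = 0) : W (d k) = 0 := by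
  funext j
  have hcross : crossDiff d W k j = 0 := by
    simp only [crossDiff_eq_of_leaders hl W k j, crossDiff_leader_eq_zero hinj hmessage, sub_zero]
  simpa only [crossDiff, hcache, sub_zero, Pi.zero_apply] using hcross

theorem HasZeroErrorScheme.uncoded (hNK : N ≤ K) :
    HasZeroErrorScheme N K K N (∑ n : Fin N, (K - (n + 1))) := by
  refine of_card (A := Fin K → ZMod 2) (X := Fin N → ZMod 2) (by simp) (by simp)
    (fun k => uncodedCache (G := ZMod 2) k) fun d => ?_
  obtain ⟨l, hinj, hl⟩ := exists_injective_apply_apply_apply_eq (by simpa using hNK) d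
  refine .of_addMonoidHom (uncodedCache (G := ZMod 2)) ?_ (uncodedDelivery d l) fun k W hcache =>
    eq_zero_of_uncodedDelivery_eq_zero hinj hl (congrFun hcache)
  simp [Finset.prod_pow_eq_pow_sum, -Finset.mem_image, Finset.card_image_of_injective _ hinj,
    Fintype.card_subtype_compl]

end Prefetching

section Achievability

variable {N K : ℕ} {M R : ℝ}

theorem cast_sum_sub_succ (hNK : N ≤ K) :
    ((∑ n : Fin N, (K - (n + 1)) : ℕ) : ℝ) = N * K - N * (N + 1) / 2 := by
  rw [Fin.sum_univ_eq_sum_range fun n => K - (n + 1)]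
  induction N with
  | zero => simp
  | succ m ih =>
    rw [Finset.sum_range_succ, Nat.cast_add, ih (Nat.le_of_succ_le hNK), Nat.cast_sub hNK]
    push_cast
    ring

theorem mul_proposedRate {t : ℝ} (hK : 0 < K) (ht : K * M = (1 - t) * 1 + t * N) :
    K * proposedRate N K M =
      (1 - t) * (N * K - N) + t * (N * K - N * (N + 1) / 2) := by
  have hK' : (K : ℝ) ≠ 0 := by positivity
  calc (K : ℝ) * proposedRate N K M = N * K - N / 2 * (K * M) - N / 2 := by
        rw [proposedRate]
        field_simp
        ring
    _ = (1 - t) * (N * K - N) + t * (N * K - N * (N + 1) / 2) := by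
        rw [ht]
        ring

theorem achievable_of_proposedRate_lt (hNK : N ≤ K) (hK : 0 < K) (hM₁ : 1 / (K : ℝ) ≤ M)
    (hM₂ : M ≤ N / (K : ℝ)) (hR : proposedRate N K M < R) : Achievable N K R M := by
  have hK' : (0 : ℝ) < K := by exact_mod_cast hK
  have hKM : (K : ℝ) * M ∈ Set.Icc 1 (N : ℝ) :=
    ⟨(div_le_iff₀' hK').mp hM₁, (le_div_iff₀' hK').mp hM₂⟩
  have hN : (1 : ℝ) ≤ N := hKM.1.trans hKM.2
  rw [← segment_eq_Icc hN, segment_eq_image] at hKM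
  obtain ⟨t, ⟨ht₀, ht₁⟩, ht⟩ := hKM
  simp only [smul_eq_mul] at ht
  refine (HasZeroErrorScheme.coded hNK).achievable_of_memory_sharing (.uncoded hNK)
    (Nat.one_le_cast.mp hN) hK ht₀ ht₁ (by simpa using ht.le) ?_
  rw [cast_sum_sub_succ hNK, Nat.cast_sub (Nat.le_mul_of_pos_right N hK), Nat.cast_mul,
    ← mul_proposedRate hK ht.symm]
  gcongr

end Achievability

/-! ### The cut-set bound -/

section CutSet

namespace CachingCode

variable {N K F : ℕ} {M R : ℝ} {ι κ : Type*} [Fintype ι] [Fintype κ]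

/-- The databases for which some user fails to reconstruct the file it requested. -/
def errorSet (C : CachingCode N K M R F) (d : Fin K → Fin N) : Finset (Fin N → Fin (2 ^ F)) :=
  Finset.univ.filter fun W => ∃ k, C.reconstruct W d k ≠ W (d k)

theorem reconstruct_eq_of_notMem_errorSet {C : CachingCode N K M R F} {d : Fin K → Fin N}
    {W : Fin N → Fin (2 ^ F)} (hW : W ∉ C.errorSet d) (k : Fin K) :
    C.reconstruct W d k = W (d k) := by
  by_contra hk
  exact hW (Finset.mem_filter.mpr ⟨Finset.mem_univ W, k, hk⟩)

theorem errorProbOf_eq (C : CachingCode N K M R F) (d : Fin K → Fin N) :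
    C.errorProbOf d = (C.errorSet d).card / 2 ^ (F * N) := by
  rw [errorProbOf, errorSet, Fintype.card_fun, Fintype.card_fin, Fintype.card_fin, ← pow_mul]
  norm_cast

theorem card_errorSet_lt {C : CachingCode N K M R F} {ε : ℝ} (hC : C.errorProb < ε)
    (d : Fin K → Fin N) : ((C.errorSet d).card : ℝ) < ε * 2 ^ (F * N) := by
  have hd : C.errorProbOf d < ε := (le_ciSup (Set.finite_range _).bddAbove d).trans_lt hC
  rwa [errorProbOf_eq, div_lt_iff₀ (by positivity)] at hd

theorem two_pow_lt_two_mul_card {C : CachingCode N K M R F} (D : κ → Fin K → Fin N)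
    (hC : C.errorProb < 1 / (2 * (Fintype.card κ + 1))) :
    2 ^ (F * N) < 2 * (Finset.univ.biUnion fun j => C.errorSet (D j))ᶜ.card := by
  set B := Finset.univ.biUnion fun j => C.errorSet (D j)
  have htotal : (B.card : ℝ) + Bᶜ.card = 2 ^ (F * N) := by
    exact_mod_cast (Finset.card_add_card_compl B).trans (by simp [pow_mul])
  have hB : (B.card : ℝ) < 1 / 2 * 2 ^ (F * N) := by
    calc (B.card : ℝ) ≤ ∑ j, ((C.errorSet (D j)).card : ℝ) := by
          exact_mod_cast Finset.card_biUnion_le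
      _ ≤ ∑ _j : κ, 1 / (2 * (Fintype.card κ + 1) : ℝ) * 2 ^ (F * N) :=
          Finset.sum_le_sum fun j _ => (card_errorSet_lt hC (D j)).le
      _ = Fintype.card κ / (Fintype.card κ + 1) * (1 / 2 * 2 ^ (F * N)) := by
          rw [Finset.sum_const, Finset.card_univ, nsmul_eq_mul]
          field_simp
      _ < 1 / 2 * 2 ^ (F * N) := by
          refine mul_lt_of_lt_one_left (by positivity) ?_
          rw [div_lt_one (by positivity)]
          exact lt_add_one _
  have hcast : (2 : ℝ) ^ (F * N) < 2 * Bᶜ.card := by linarith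
  exact_mod_cast hcast

theorem card_le_of_cover (C : CachingCode N K M R F) (u : ι → Fin K) (D : κ → Fin K → Fin N)
    (hcover : ∀ n, ∃ i j, D j (u i) = n) {S : Finset (Fin N → Fin (2 ^ F))}
    (hS : ∀ W ∈ S, ∀ j, W ∉ C.errorSet (D j)) :
    S.card ≤ 2 ^ (Fintype.card ι * ⌊(F : ℝ) * M⌋₊ + Fintype.card κ * ⌊(F : ℝ) * R⌋₊) := by
  classical
  let view (W : Fin N → Fin (2 ^ F)) :=
    ((fun i => C.cache (u i) W, fun j => C.encode W (D j)) :
      (ι → Fin (2 ^ ⌊(F : ℝ) * M⌋₊)) × (κ → Fin (2 ^ ⌊(F : ℝ) * R⌋₊)))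
  have hinj : Set.InjOn view S := by
    intro W hW W' hW' hview
    obtain ⟨hcache, hmessage⟩ := Prod.mk.inj hview
    funext n
    obtain ⟨i, j, rfl⟩ := hcover n
    rw [← reconstruct_eq_of_notMem_errorSet (hS W hW j),
      ← reconstruct_eq_of_notMem_errorSet (hS W' hW' j)]
    simp only [reconstruct, congrFun hcache i, congrFun hmessage j]
  calc S.card ≤ (Finset.univ : Finset _).card :=
        Finset.card_le_card_of_injOn view (fun _ _ => Finset.mem_univ _) hinj
    _ = _ := by
        simp [← pow_mul, ← pow_add, mul_comm]

theorem mul_le_of_cover {C : CachingCode N K M R F} (u : ι → Fin K) (D : κ → Fin K → Fin N)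
    (hcover : ∀ n, ∃ i j, D j (u i) = n)
    (hC : C.errorProb < 1 / (2 * (Fintype.card κ + 1))) :
    F * N ≤ Fintype.card ι * ⌊(F : ℝ) * M⌋₊ + Fintype.card κ * ⌊(F : ℝ) * R⌋₊ := by
  classical
  have hlarge := two_pow_lt_two_mul_card D hC
  have hsmall := C.card_le_of_cover u D hcover
    (S := (Finset.univ.biUnion fun j => C.errorSet (D j))ᶜ) fun W hW j hj =>
      Finset.mem_compl.mp hW (Finset.mem_biUnion.mpr ⟨j, Finset.mem_univ j, hj⟩)
  refine Nat.lt_succ_iff.mp ((Nat.pow_lt_pow_iff_right one_lt_two).mp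
    (hlarge.trans_le ?_))
  rw [pow_succ']
  gcongr

end CachingCode

namespace Achievable

variable {N K s b : ℕ} {M R : ℝ}

theorem le_of_cover {ι κ : Type*} [Fintype ι] [Fintype κ] (h : Achievable N K R M) (hM : 0 ≤ M)
    (u : ι → Fin K) (D : κ → Fin K → Fin N) (hcover : ∀ n, ∃ i j, D j (u i) = n) :
    (N : ℝ) ≤ Fintype.card ι * M + Fintype.card κ * R := by
  obtain ⟨hR, h⟩ := h
  obtain ⟨F, hF, C, hC⟩ := h (1 / (2 * (Fintype.card κ + 1))) (by positivity)
  refine le_of_mul_le_mul_left ?_ (show (0 : ℝ) < F by exact_mod_cast hF)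
  calc (F * N : ℝ)
      ≤ Fintype.card ι * ⌊(F : ℝ) * M⌋₊ + Fintype.card κ * ⌊(F : ℝ) * R⌋₊ := by
        exact_mod_cast C.mul_le_of_cover u D hcover hC
    _ ≤ Fintype.card ι * (F * M) + Fintype.card κ * (F * R) := by
        gcongr <;> exact Nat.floor_le (by positivity)
    _ = F * (Fintype.card ι * M + Fintype.card κ * R) := by ring

theorem le_of_le_mul (h : Achievable N K R M) (hM : 0 ≤ M) (hs : s ≤ K) (hN : N ≤ s * b) :
    (N : ℝ) ≤ s * M + b * R := by
  rcases Nat.eq_zero_or_pos N with rfl | hN₀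
  · have hR : 0 ≤ R := h.1
    simpa using (by positivity : 0 ≤ s * M + b * R)
  let D (j : Fin b) (k : Fin K) : Fin N := ⟨(k + s * j) % N, Nat.mod_lt _ hN₀⟩
  have hcover (n : Fin N) : ∃ i j, D j (Fin.castLE hs i) = n := by
    have hn : (n : ℕ) < s * b := n.2.trans_le hN
    have hs₀ : 0 < s := Nat.pos_of_mul_pos_right (n.1.zero_le.trans_lt hn)
    refine ⟨⟨n % s, Nat.mod_lt _ hs₀⟩, ⟨n / s, Nat.div_lt_of_lt_mul hn⟩, Fin.ext ?_⟩
    simp [D, Nat.mod_add_div, Nat.mod_eq_of_lt]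
  simpa using h.le_of_cover hM (Fin.castLE hs) D hcover

theorem proposedRate_le_two_mul (h : Achievable N K R M) (hNK : N ≤ K) (hM : 0 ≤ M)
    (hM' : M ≤ N / (K : ℝ)) : proposedRate N K M ≤ 2 * R := by
  have hcut : (N : ℝ) ≤ ((N + 1) / 2 : ℕ) * M + (2 : ℕ) * R :=
    h.le_of_le_mul hM (by omega) (by omega)
  have hhalf : (((N + 1) / 2 : ℕ) : ℝ) ≤ (N + 1) / 2 := by
    simpa using Nat.cast_div_le (m := N + 1) (n := 2) (α := ℝ)
  push_cast at hcut
  calc proposedRate N K M = N - N * M / 2 - N / (K : ℝ) / 2 := by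
        rw [proposedRate]
        ring
    _ ≤ N - N * M / 2 - M / 2 := by gcongr
    _ = N - (N + 1) / 2 * M := by ring
    _ ≤ N - ((N + 1) / 2 : ℕ) * M := by gcongr
    _ ≤ 2 * R := by linarith

end Achievable

end CutSet

theorem proposedRate_pos {N K : ℕ} {M : ℝ} (hN : 0 < N) (hNK : N ≤ K) (hK : 1 < K)
    (hM : M ≤ N / (K : ℝ)) : 0 < proposedRate N K M := by
  have hN' : (0 : ℝ) < N := by exact_mod_cast hN
  have hNK' : (N : ℝ) ≤ K := by exact_mod_cast hNK
  have hK' : (1 : ℝ) < K := by exact_mod_cast hK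
  have hlt : M + 1 / K < 2 := by
    calc M + 1 / K ≤ N / K + 1 / K := by gcongr
      _ = (N + 1) / K := by ring
      _ < 2 := by
        rw [div_lt_iff₀ (by linarith)]
        linarith
  calc 0 < N * (1 - (M + 1 / K) / 2) := mul_pos hN' (by linarith)
    _ = proposedRate N K M := by
        rw [proposedRate]
        ring

theorem theorem2_general (N K : ℕ) (hNK : N ≤ K) (hK : 1 < K) (M : ℝ)
    (hM₁ : 1 / (K : ℝ) ≤ M) (hM₂ : M ≤ N / (K : ℝ)) :
    (∀ R : ℝ, proposedRate N K M < R → Achievable N K R M) ∧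
      0 < optimalRate N K M ∧
      proposedRate N K M / optimalRate N K M ≤ 2 := by
  have hM : 0 ≤ M := le_trans (by positivity) hM₁
  have hN : 0 < N := by
    have hK₀ : (0 : ℝ) < K := by positivity
    have : (0 : ℝ) < N / K := (one_div_pos.mpr hK₀).trans_le (hM₁.trans hM₂)
    exact_mod_cast (div_pos_iff_of_pos_right hK₀).mp this
  have hach (R : ℝ) (hR : proposedRate N K M < R) : Achievable N K R M :=
    achievable_of_proposedRate_lt hNK (zero_lt_one.trans hK) hM₁ hM₂ hR
  have hlower : proposedRate N K M / 2 ≤ optimalRate N K M :=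
    le_csInf ⟨_, hach _ (lt_add_one _)⟩ fun R hR =>
      (div_le_iff₀' two_pos).mpr (hR.proposedRate_le_two_mul hNK hM hM₂)
  have hopt : 0 < optimalRate N K M :=
    (half_pos (proposedRate_pos hN hNK hK hM₂)).trans_le hlower
  exact ⟨hach, hopt, (div_le_iff₀ hopt).mpr ((div_le_iff₀' two_pos).mp hlower)⟩

/-- For `K > N ≥ 3` and `1 / K ≤ M ≤ (N - 1) / K`, the rate `R_c(M)` is achieved (every larger
rate is achievable with cache capacity `M`), and it is within a factor `2` of the optimal rate
`R*(M)`, which is positive. -/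
theorem theorem2 (N K : ℕ) (hN : 3 ≤ N) (hK : N < K) (M : ℝ)
    (hM₁ : 1 / (K : ℝ) ≤ M) (hM₂ : M ≤ ((N : ℝ) - 1) / (K : ℝ)) :
    (∀ R : ℝ, proposedRate N K M < R → Achievable N K R M) ∧
      0 < optimalRate N K M ∧
      proposedRate N K M / optimalRate N K M ≤ 2 :=
  theorem2_general N K hK.le (by omega) M hM₁ (hM₂.trans (by gcongr; linarith))
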